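/- Let $X$ be a real or complex Banach space which is L-embedded, that is, there is a linear projection $P$ on the bidual $X''$ whose range is (the canonical image of) $X$ and which satisfies $\|\xi\| = \|P\xi\| + \|\xi - P\xi\|$ for all $\xi\in X''$. Let $Y$ be a nonreflexive closed linear subspace of $X$. Then: (a) $Y$ contains an asymptotically isometric copy of $\ell^1$: there is a closed linear subspace $Z$ of $Y$ with a Schauder basis $(x_n)$ and a sequence $(\delta_n)$ in $[0,1)$ tending to $0$ such that $$\sum_{n}(1-\delta_n)|\alpha_n| \le \Bigl\|\sum_{n}\alpha_n x_n\Bigr\| \le \sum_{n}|\alpha_n|$$ for all scalar sequences $(\alpha_n)\in\ell^1$. (b) Consequently $Y$ fails the fixed point property for contractive maps: there are a nonempty closed bounded convex set $C\subset Y$ and a (not necessarily linear) map $f\colon C\to C$ with $\|f(x)-f(y)\|<\|x-y\|$ for all $x\ne y$ in $C$ such that $f$ has no fixed point. -/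

import Mathlib

/-- A normed space is reflexive if the canonical embedding into its bidual is onto. -/
def IsReflexiveSpace (𝕜 : Type*) [RCLike 𝕜] (E : Type*) [NormedAddCommGroup E]
    [NormedSpace 𝕜 E] : Prop :=
  Function.Surjective (NormedSpace.inclusionInDoubleDual 𝕜 E)

/-- A linear subspace of a normed space `F` is an L-summand in `F` if it is the range of an
L-projection on `F`, i.e. of a projection `P` with `‖x‖ = ‖P x‖ + ‖x - P x‖` for all `x`. -/
def IsLSummand (𝕜 : Type*) [RCLike 𝕜] {F : Type*} [NormedAddCommGroup F]
    [NormedSpace 𝕜 F] (S : Submodule 𝕜 F) : Prop :=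
  ∃ P : F →L[𝕜] F, IsLprojection F P ∧ P.range = S

/-- `E` is L-embedded if (the canonical image of) `E` is an L-summand in its bidual. -/
def IsLEmbedded (𝕜 : Type*) [RCLike 𝕜] (E : Type*) [NormedAddCommGroup E]
    [NormedSpace 𝕜 E] : Prop :=
  IsLSummand 𝕜 (F := StrongDual 𝕜 (StrongDual 𝕜 E)) (NormedSpace.inclusionInDoubleDual 𝕜 E).range

/-- The sequence `x` spans `ℓ¹` asymptotically isometrically: there is a sequence `δ` in `[0, 1)`
tending to `0` such that
`∑ (1 - δ n) |α n| ≤ ‖∑ α n • x n‖ ≤ ∑ |α n|` for all `α` in `ℓ¹`. -/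
def SpansL1Asymptotically (𝕜 : Type*) [RCLike 𝕜] {E : Type*} [NormedAddCommGroup E]
    [NormedSpace 𝕜 E] (x : ℕ → E) : Prop :=
  ∃ δ : ℕ → ℝ, (∀ n, 0 ≤ δ n ∧ δ n < 1) ∧ Filter.Tendsto δ Filter.atTop (nhds 0) ∧
    ∀ α : ℕ → 𝕜, Summable (fun n => ‖α n‖) →
      Summable (fun n => α n • x n) ∧
        ∑' n, (1 - δ n) * ‖α n‖ ≤ ‖∑' n, α n • x n‖ ∧
        ‖∑' n, α n • x n‖ ≤ ∑' n, ‖α n‖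

/-- A normed space is asymptotically isometric to `ℓ¹` if it has a Schauder basis which spans `ℓ¹`
asymptotically isometrically. -/
def IsAsymptoticallyIsometricL1 (𝕜 : Type*) [RCLike 𝕜] (E : Type*) [NormedAddCommGroup E]
    [NormedSpace 𝕜 E] : Prop :=
  ∃ b : SchauderBasis 𝕜 E, SpansL1Asymptotically 𝕜 b.basis

/-- `E` contains an asymptotically isometric copy of `ℓ¹`. -/
def ContainsAsymptoticL1 (𝕜 : Type*) [RCLike 𝕜] (E : Type*) [NormedAddCommGroup E]
    [NormedSpace 𝕜 E] : Prop :=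
  ∃ Z : Submodule 𝕜 E, IsClosed (Z : Set E) ∧ IsAsymptoticallyIsometricL1 𝕜 Z

/-- A self-map `f` of a subset `C` of a normed space is contractive if it strictly decreases
distances of distinct points. -/
def IsContractiveMap {E : Type*} [NormedAddCommGroup E] {C : Set E} (f : C → C) : Prop :=
  ∀ x y : C, x ≠ y → ‖(f x : E) - (f y : E)‖ < ‖(x : E) - (y : E)‖

/-- The fixed point property (for contractive maps): every contractive self-map of a nonempty
closed bounded convex subset has a fixed point. -/
def HasFixedPointProperty (𝕜 : Type*) [RCLike 𝕜] (E : Type*) [NormedAddCommGroup E]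
    [NormedSpace 𝕜 E] : Prop :=
  letI : NormedSpace ℝ E := NormedSpace.restrictScalars ℝ 𝕜 E
  ∀ C : Set E, C.Nonempty → IsClosed C → Bornology.IsBounded C → Convex ℝ C →
    ∀ f : C → C, IsContractiveMap f → ∃ x : C, f x = x

/-!
The bidual of `Y` sits in the bidual of `X` as the bipolar of `Y`. An element of it outside `Y`
splits, by the L-projection, as `x + η` with `x ∈ X` and `η ≠ 0` in the complement of `X`, and after
scaling `‖η‖ = 1` and `‖e + a η‖ = ‖e‖ + |a|` for all `e ∈ X` and scalars `a`
(`IsLEmbedded.exists_singular`). By Helly's lemma, applied to the quotient map `X → X ⧸ Y` together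
with finitely many functionals, `η` is approximated on these functionals by vectors `z` with
`z + x ∈ Y` and norm almost `1` (`exists_translate_mem_approx`); since finitely many functionals
almost determine the norm on the bounded part of a finite-dimensional `F`, such a `z` can be chosen
almost `ℓ¹`-orthogonal to `F` (`exists_translate_mem_almost_orthogonal`). Iterating gives a sequence
`z` that spans `ℓ¹` asymptotically. It lies in `-x + Y` and not in `Y`, but the differences
`z (2 n) - z (2 n + 1)` lie in `Y`, and halving them gives, up to factors tending to one, a sequence
of the same kind (`exists_spansL1Asymptotically_of_translate`).

The synthesis operator `a ↦ ∑ a n • y n` of the resulting sequence is an isomorphism of `ℓ¹` onto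
its range, which is the required copy of `ℓ¹`. For the fixed point property, passing to a
subsequence and multiplying by scalars decreasing to one makes the shift of
coefficients contractive on the set of infinite convex combinations, where it has no fixed point
(`exists_isContractiveMap_forall_ne`).
-/

/-! ### A Helly-type lemma and finite approximation of bidual elements -/

/-- **Helly's lemma** (approximate form): if the vector `v` is the image of the bidual element `η`
under the second adjoint of `S`, then `v` is a limit of images `S z` with `‖z‖ ≤ r`,
for every `r > ‖η‖`. -/
theorem mem_closure_image_closedBall_of_bidual {𝕜 X V : Type*} [RCLike 𝕜]
    [NormedAddCommGroup X] [NormedSpace 𝕜 X] [NormedAddCommGroup V] [NormedSpace 𝕜 V]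
    (S : X →L[𝕜] V) (η : StrongDual 𝕜 (StrongDual 𝕜 X)) (v : V)
    (hv : ∀ c : StrongDual 𝕜 V, c v = η (c.comp S)) {r : ℝ} (hr : ‖η‖ < r) :
    v ∈ closure (S '' Metric.closedBall 0 r) := by
  let _ : NormedSpace ℝ X := NormedSpace.restrictScalars ℝ 𝕜 X
  let _ : NormedSpace ℝ V := NormedSpace.restrictScalars ℝ 𝕜 V
  have : IsScalarTower ℝ 𝕜 X := RestrictScalars.isScalarTower ℝ 𝕜 X
  have : IsScalarTower ℝ 𝕜 V := RestrictScalars.isScalarTower ℝ 𝕜 V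
  have hr0 : 0 < r := (norm_nonneg η).trans_lt hr
  by_contra hnot
  have hconv : Convex ℝ (closure (S '' Metric.closedBall 0 r)) :=
    ((convex_closedBall (0 : X) r).linear_image ((S : X →ₗ[𝕜] V).restrictScalars ℝ)).closure
  obtain ⟨c, s, hs, hsv⟩ :=
    RCLike.geometric_hahn_banach_closed_point (𝕜 := 𝕜) hconv isClosed_closure hnot
  have hball : ∀ w : X, ‖w‖ ≤ r → RCLike.re (c (S w)) < s := fun w hw =>
    hs _ (subset_closure ⟨w, by simpa using hw, rfl⟩)
  have hs0 : 0 < s := by simpa using hball 0 (by simpa using hr0.le)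
  -- Rotating the argument turns the bound on real parts into one on absolute values.
  have habs : ∀ w : X, ‖w‖ ≤ r → ‖c (S w)‖ ≤ s := by
    intro w hw
    obtain ⟨u, hu, hu'⟩ := RCLike.exists_norm_mul_eq_self (c (S w))
    by_cases h0 : c (S w) = 0
    · simpa [h0] using hs0.le
    have hu0 : u ≠ 0 := by rintro rfl; simp at hu
    have h1 := hball (u⁻¹ • w) (by rw [norm_smul, norm_inv, hu]; simpa using hw)
    have h2 : c (S (u⁻¹ • w)) = ((‖c (S w)‖ : ℝ) : 𝕜) := by
      rw [map_smul, map_smul, smul_eq_mul, inv_mul_eq_iff_eq_mul₀ hu0, hu']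
    rw [h2, RCLike.ofReal_re] at h1
    exact h1.le
  have hnorm : ‖c.comp S‖ ≤ s / r :=
    ContinuousLinearMap.opNorm_bound_of_ball_bound hr0 s _ fun w hw => habs w (by simpa using hw)
  have : RCLike.re (c v) ≤ s := by
    rw [hv]
    calc RCLike.re (η (c.comp S)) ≤ ‖η (c.comp S)‖ := RCLike.re_le_norm _
      _ ≤ ‖η‖ * ‖c.comp S‖ := η.le_opNorm _
      _ ≤ r * (s / r) := by gcongr
      _ = s := by field_simp
  linarith

/-- Suppose that `η` restricts to `φ ↦ -φ x` on the annihilator of the closed subspace `Y`, that is,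
`x + η` lies in the bipolar of `Y`. Then `η` can be approximated on finitely many functionals by
elements of `-x + Y` of almost the same norm. -/
theorem exists_translate_mem_approx {𝕜 X : Type*} [RCLike 𝕜]
    [NormedAddCommGroup X] [NormedSpace 𝕜 X] (Y : Submodule 𝕜 X) (hYc : IsClosed (Y : Set X))
    (x : X) (η : StrongDual 𝕜 (StrongDual 𝕜 X))
    (hη : ∀ φ : StrongDual 𝕜 X, (∀ y ∈ Y, φ y = 0) → η φ = -φ x)
    (Φ : Finset (StrongDual 𝕜 X)) (hΦ : ∀ φ ∈ Φ, ‖φ‖ ≤ 1) {ε : ℝ} (hε : 0 < ε) :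
    ∃ z : X, z + x ∈ Y ∧ ‖z‖ < ‖η‖ + ε ∧ ∀ φ ∈ Φ, ‖φ z - η φ‖ < ε := by
  have : IsClosed (Y : Set X) := hYc
  let T : X →L[𝕜] (Φ → 𝕜) := ContinuousLinearMap.pi fun φ => (φ : StrongDual 𝕜 X)
  let S : X →L[𝕜] (X ⧸ Y) × (Φ → 𝕜) := Y.mkQL.prod T
  have hmem := mem_closure_image_closedBall_of_bidual S η (-(Y.mkQ x), fun φ => η φ) (by
    intro c
    let c₁ : StrongDual 𝕜 (X ⧸ Y) := c.comp (ContinuousLinearMap.inl 𝕜 _ _)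
    let c₂ : StrongDual 𝕜 (Φ → 𝕜) := c.comp (ContinuousLinearMap.inr 𝕜 _ _)
    classical
    have hc₂ : c₂.comp T = ∑ φ : Φ, c₂ (fun ψ => if φ = ψ then 1 else 0) •
        (φ : StrongDual 𝕜 X) := by
      ext w
      simpa [T, mul_comm] using LinearMap.pi_apply_eq_sum_univ (c₂ : (Φ → 𝕜) →ₗ[𝕜] 𝕜) (T w)
    have hcS : c.comp S = c₁.comp Y.mkQL + c₂.comp T := by
      ext w
      simp [c₁, c₂, S, ← map_add]
    have h₁ : η (c₁.comp Y.mkQL) = -c₁ (Y.mkQ x) :=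
      hη _ fun y hy => by
        have : Y.mkQL y = 0 := (Submodule.Quotient.mk_eq_zero Y).2 hy
        simp [this]
    have h₂ : η (c₂.comp T) = c₂ fun φ => η φ := by
      rw [hc₂, map_sum]
      simpa [mul_comm] using
        (LinearMap.pi_apply_eq_sum_univ (c₂ : (Φ → 𝕜) →ₗ[𝕜] 𝕜) fun φ => η φ).symm
    rw [hcS, map_add, h₁, h₂, ← map_neg c₁]
    change _ = c _ + c _
    rw [← map_add]
    simp) (r := ‖η‖ + ε / 3) (by linarith)
  obtain ⟨_, ⟨z, hz, rfl⟩, hdist⟩ := Metric.mem_closure_iff.1 hmem (ε / 3) (by positivity)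
  rw [dist_comm, dist_eq_norm, Prod.norm_def, max_lt_iff] at hdist
  obtain ⟨hq, hp⟩ := hdist
  have hq' : ‖Y.mkQ (z + x)‖ < ε / 3 := by simpa [S] using hq
  obtain ⟨m, hm, hmε⟩ := Submodule.Quotient.norm_mk_lt (Y.mkQ (z + x)) (sub_pos.2 hq')
  rw [add_sub_cancel] at hmε
  have hz' : ‖z‖ ≤ ‖η‖ + ε / 3 := by simpa using hz
  refine ⟨z - m, ?_, ?_, fun φ hφ => ?_⟩
  · have := (Submodule.Quotient.eq Y).1 hm.symm
    convert this using 1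
    abel
  · linarith [norm_sub_le z m]
  · have h1 : ‖φ z - η φ‖ < ε / 3 := by
      simpa [S, T] using (norm_le_pi_norm _ (⟨φ, hφ⟩ : Φ)).trans_lt hp
    have h2 : ‖φ m‖ < ε / 3 := by
      have := φ.le_of_opNorm_le (hΦ φ hφ) m
      linarith
    have h3 : φ (z - m) - η φ = (φ z - η φ) - φ m := by rw [map_sub]; ring
    rw [h3]
    linarith [norm_sub_le (φ z - η φ) (φ m)]

/-! ### Almost `ℓ¹`-orthogonal sequences -/

/-- If a bidual element `η` of norm one is `ℓ¹`-orthogonal to `X`, then the elements of `-x + Y`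
approximating it are almost `ℓ¹`-orthogonal to any given finite-dimensional subspace `F`:
by compactness finitely many functionals are enough to witness the norm on `F + 𝕜 η`. -/
theorem exists_translate_mem_almost_orthogonal {𝕜 X : Type*} [RCLike 𝕜]
    [NormedAddCommGroup X] [NormedSpace 𝕜 X] (Y : Submodule 𝕜 X) (hYc : IsClosed (Y : Set X))
    (x : X) (η : StrongDual 𝕜 (StrongDual 𝕜 X)) (hη1 : ‖η‖ = 1)
    (hη : ∀ φ : StrongDual 𝕜 X, (∀ y ∈ Y, φ y = 0) → η φ = -φ x)
    (horth : ∀ e : X, ‖NormedSpace.inclusionInDoubleDual 𝕜 X e + η‖ = ‖e‖ + 1)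
    (F : Submodule 𝕜 X) [FiniteDimensional 𝕜 F] {ε : ℝ} (hε : 0 < ε) :
    ∃ z : X, z + x ∈ Y ∧ ‖z‖ < 1 + ε ∧
      ∀ e ∈ F, ∀ a : 𝕜, (1 - ε) * (‖e‖ + ‖a‖) ≤ ‖e + a • z‖ := by
  have : ProperSpace F := FiniteDimensional.proper_rclike 𝕜 F
  obtain ⟨t, -, htfin, htcov⟩ :=
    (isCompact_closedBall (0 : F) (3 / ε)).finite_cover_balls (e := ε / 4) (by positivity)
  have hφ : ∀ e : F, ∃ φ : StrongDual 𝕜 X, ‖φ‖ ≤ 1 ∧ ‖(e : X)‖ + 1 - ε / 4 < ‖φ e + η φ‖ := by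
    intro e
    obtain ⟨φ, hφ1, hφ2⟩ := ContinuousLinearMap.exists_lt_apply_of_lt_opNorm
      (NormedSpace.inclusionInDoubleDual 𝕜 X e + η) (r := ‖(e : X)‖ + 1 - ε / 4)
      (by rw [horth]; linarith)
    exact ⟨φ, hφ1.le, by simpa using hφ2⟩
  choose φ hφ1 hφ2 using hφ
  classical
  obtain ⟨z, hzY, hz, hzφ⟩ := exists_translate_mem_approx Y hYc x η hη (htfin.toFinset.image φ)
    (by simp only [Finset.mem_image]; rintro _ ⟨e, -, rfl⟩; exact hφ1 e)
    (ε := ε / 4) (by positivity)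
  rw [hη1] at hz
  have hunit : ∀ e ∈ F, (1 - ε) * (‖e‖ + 1) ≤ ‖e + z‖ := by
    intro e he
    -- Beyond radius `3 / ε` the triangle inequality and `‖z‖ < 1 + ε / 4` suffice.
    rcases le_or_gt ‖e‖ (3 / ε) with hle | hgt
    · have hmem : (⟨e, he⟩ : F) ∈ Metric.closedBall (0 : F) (3 / ε) := by simpa using hle
      obtain ⟨e', he', hee'⟩ := Set.mem_iUnion₂.1 (htcov hmem)
      have hd : ‖e - e'‖ < ε / 4 := by simpa [dist_eq_norm] using hee'
      have h1 := hφ2 e'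
      have h2 := hzφ (φ e') (Finset.mem_image_of_mem φ (htfin.mem_toFinset.2 he'))
      have h3 : ‖φ e' (e' + z)‖ ≤ ‖(e' : X) + z‖ := by
        simpa using (φ e').le_of_opNorm_le (hφ1 e') (e' + z)
      have h4 : ‖φ e' e' + η (φ e')‖ ≤ ‖φ e' (e' + z)‖ + ‖φ e' z - η (φ e')‖ := by
        have : φ e' e' + η (φ e') = φ e' (e' + z) - (φ e' z - η (φ e')) := by
          rw [map_add]; ring
        rw [this]
        exact norm_sub_le _ _
      have h5 : ‖(e' : X) + z‖ ≤ ‖e + z‖ + ‖e - e'‖ := by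
        have : (e' : X) + z = (e + z) - (e - e') := by abel
        rw [this]
        exact norm_sub_le _ _
      have h6 : ‖e‖ ≤ ‖(e' : X)‖ + ‖e - e'‖ := by
        simpa [add_comm] using norm_le_norm_add_norm_sub' e (e' : X)
      nlinarith [norm_nonneg e]
    · have h1 : ‖e‖ ≤ ‖e + z‖ + ‖z‖ := by
        simpa using norm_sub_le (e + z) z
      have h2 : 3 < ‖e‖ * ε := (div_lt_iff₀ hε).1 hgt
      nlinarith
  refine ⟨z, hzY, by linarith, fun e he a => ?_⟩
  rcases eq_or_ne a 0 with rfl | ha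
  · simp only [norm_zero, add_zero, zero_smul]
    nlinarith [norm_nonneg e]
  · have h := hunit (a⁻¹ • e) (F.smul_mem _ he)
    have ha' : 0 < ‖a‖ := norm_pos_iff.2 ha
    have h1 : e + a • z = a • (a⁻¹ • e + z) := by rw [smul_add, smul_inv_smul₀ ha]
    rw [h1, norm_smul]
    have h2 : (1 - ε) * (‖e‖ + ‖a‖) = ‖a‖ * ((1 - ε) * (‖a⁻¹ • e‖ + 1)) := by
      rw [norm_smul, norm_inv]
      field_simp
    rw [h2]
    gcongr

/-- Iterating a choice of vectors that are almost `ℓ¹`-orthogonal to given finite-dimensional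
subspaces, with summable errors, yields a sequence satisfying lower `ℓ¹`-estimates. -/
theorem exists_seq_of_almost_orthogonal {𝕜 X : Type*} [RCLike 𝕜]
    [NormedAddCommGroup X] [NormedSpace 𝕜 X] (p : ℕ → X → Prop)
    (h : ∀ (F : Submodule 𝕜 X) [FiniteDimensional 𝕜 F] (n : ℕ), ∃ z : X, p n z ∧
      ∀ e ∈ F, ∀ a : 𝕜, (1 - (1 / 2 : ℝ) ^ (n + 2)) * (‖e‖ + ‖a‖) ≤ ‖e + a • z‖) :
    ∃ z : ℕ → X, (∀ n, p n (z n)) ∧ ∀ (N : ℕ) (α : ℕ → 𝕜),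
      ∑ i ∈ Finset.range N, (1 - (1 / 2 : ℝ) ^ (i + 1)) * ‖α i‖ ≤
        ‖∑ i ∈ Finset.range N, α i • z i‖ := by
  classical
  choose g hgp hg using fun (s : Finset X) (n : ℕ) => h (Submodule.span 𝕜 (s : Set X)) n
  -- `s n` collects the vectors chosen before stage `n`.
  let s : ℕ → Finset X := fun n => Nat.rec ∅ (fun k t => insert (g t k) t) n
  have hs : ∀ n, s (n + 1) = insert (g (s n) n) (s n) := fun n => rfl
  have hmono : Monotone s := monotone_nat_of_le_succ fun n => by
    rw [hs]; exact Finset.subset_insert _ _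
  refine ⟨fun n => g (s n) n, fun n => hgp _ _, fun N α => ?_⟩
  have hmem : ∀ i N, i < N → g (s i) i ∈ s N := fun i N hi =>
    hmono hi (by rw [hs]; exact Finset.mem_insert_self _ _)
  -- The sharper constants `1 - 2⁻¹ ^ (i + 1) + 2⁻¹ ^ (N + 1)` make the induction go through.
  have key : ∀ N, ∑ i ∈ Finset.range N,
      (1 - (1 / 2 : ℝ) ^ (i + 1) + (1 / 2 : ℝ) ^ (N + 1)) * ‖α i‖ ≤
        ‖∑ i ∈ Finset.range N, α i • g (s i) i‖ := by
    intro N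
    induction N with
    | zero => simp
    | succ N ih =>
      rw [Finset.sum_range_succ _ N, Finset.sum_range_succ _ N]
      refine le_trans ?_ (hg (s N) N _ (Submodule.sum_mem _ fun i hi =>
        Submodule.smul_mem _ _ (Submodule.subset_span (hmem i N (Finset.mem_range.1 hi)))) (α N))
      set q : ℝ := (1 / 2) ^ (N + 2) with hq
      have hq0 : 0 ≤ q := by positivity
      have hq1 : q ≤ 1 := pow_le_one₀ (by norm_num) (by norm_num)
      have hq2 : (1 / 2 : ℝ) ^ (N + 1) = 2 * q := by rw [hq, pow_succ _ (N + 1)]; ring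
      rw [mul_add]
      refine add_le_add ?_ (by rw [hq2]; nlinarith [norm_nonneg (α N)])
      refine le_trans ?_ (mul_le_mul_of_nonneg_left ih (sub_nonneg.2 hq1))
      rw [Finset.mul_sum]
      refine Finset.sum_le_sum fun i hi => ?_
      rw [← mul_assoc]
      refine mul_le_mul_of_nonneg_right ?_ (norm_nonneg _)
      have hi' : (1 / 2 : ℝ) ^ (N + 1) ≤ (1 / 2 : ℝ) ^ (i + 1) :=
        pow_le_pow_of_le_one (by norm_num) (by norm_num)
          (Nat.succ_le_succ (Finset.mem_range.1 hi).le)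
      rw [hq2] at hi' ⊢
      nlinarith
  refine le_trans (Finset.sum_le_sum fun i _ => ?_) (key N)
  gcongr
  simp

/-! ### The singular part of a bidual element -/

/-- The component of a vector `b ∉ S` complementary to the L-summand `S` can be scaled to norm one,
and is then `ℓ¹`-orthogonal to `S`. -/
theorem IsLSummand.exists_norm_add_eq {𝕜 B : Type*} [RCLike 𝕜] [NormedAddCommGroup B]
    [NormedSpace 𝕜 B] {S : Submodule 𝕜 B} (hS : IsLSummand 𝕜 S) {b : B} (hb : b ∉ S) :
    ∃ s ∈ S, ∃ c : 𝕜, ‖c • (b - s)‖ = 1 ∧ ∀ t ∈ S, ‖t + c • (b - s)‖ = ‖t‖ + 1 := by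
  obtain ⟨P, hP, rfl⟩ := hS
  have hfix : ∀ t ∈ P.range, P t = t := by
    rintro _ ⟨w, rfl⟩
    exact DFunLike.congr_fun hP.proj w
  have hPb : P b ∈ P.range := ⟨b, rfl⟩
  have hne : b - P b ≠ 0 := fun h0 => hb (by rwa [← sub_eq_zero.1 h0] at hPb)
  have hc : ‖((‖b - P b‖⁻¹ : ℝ) : 𝕜) • (b - P b)‖ = 1 := by
    rw [norm_smul, RCLike.norm_ofReal, abs_of_nonneg (by positivity),
      inv_mul_cancel₀ (norm_ne_zero_iff.2 hne)]
  refine ⟨P b, hPb, _, hc, fun t ht => ?_⟩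
  have h1 := hP.Lnorm (t + ((‖b - P b‖⁻¹ : ℝ) : 𝕜) • (b - P b))
  have h2 : P • (t + ((‖b - P b‖⁻¹ : ℝ) : 𝕜) • (b - P b)) = t := by
    rw [ContinuousLinearMap.smul_def, map_add, map_smul, map_sub, hfix t ht, hfix _ hPb, sub_self,
      smul_zero, add_zero]
  rwa [sub_smul, h2, one_smul, add_sub_cancel_left, hc] at h1

/-- A functional on the dual of `X` that factors through restriction to the closed subspace `Y`
comes from `Y` as soon as it comes from `X`. -/
theorem exists_eq_inclusionInDoubleDual_of_comp_restrict {𝕜 X : Type*} [RCLike 𝕜]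
    [NormedAddCommGroup X] [NormedSpace 𝕜 X] (Y : Submodule 𝕜 X) (hYc : IsClosed (Y : Set X))
    (ξ : StrongDual 𝕜 (StrongDual 𝕜 Y)) (x : X)
    (h : ∀ φ : StrongDual 𝕜 X, ξ (φ.comp Y.subtypeL) = φ x) :
    ∃ y : Y, NormedSpace.inclusionInDoubleDual 𝕜 Y y = ξ := by
  have hx : x ∈ Y := by
    have : IsClosed (Y : Set X) := hYc
    rw [← Submodule.Quotient.mk_eq_zero]
    refine SeparatingDual.eq_zero_of_forall_dual_eq_zero (R := 𝕜) fun g => ?_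
    have h1 : (g.comp Y.mkQL).comp Y.subtypeL = 0 := by
      ext y
      have : Y.mkQL y = 0 := (Submodule.Quotient.mk_eq_zero Y).2 y.2
      simp [this]
    have h2 := h (g.comp Y.mkQL)
    rw [h1, map_zero] at h2
    exact h2.symm
  refine ⟨⟨x, hx⟩, ?_⟩
  ext g
  obtain ⟨φ, hφ, -⟩ := exists_extension_norm_eq Y g
  have hg : φ.comp Y.subtypeL = g := by
    ext y
    exact hφ y
  rw [← hg, h]
  rfl

/-- A nonreflexive closed subspace `Y` of an L-embedded space `X` produces a bidual element `η` of
norm one which is `ℓ¹`-orthogonal to `X` and has a translate `x + η` in the bipolar of `Y`: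
take `ξ` in the bidual of `Y` outside `Y`, and normalise its component outside `X`. -/
theorem IsLEmbedded.exists_singular {𝕜 X : Type*} [RCLike 𝕜]
    [NormedAddCommGroup X] [NormedSpace 𝕜 X] (hX : IsLEmbedded 𝕜 X) (Y : Submodule 𝕜 X)
    (hYc : IsClosed (Y : Set X)) (hY : ¬ IsReflexiveSpace 𝕜 Y) :
    ∃ (x : X) (η : StrongDual 𝕜 (StrongDual 𝕜 X)), ‖η‖ = 1 ∧
      (∀ φ : StrongDual 𝕜 X, (∀ y ∈ Y, φ y = 0) → η φ = -φ x) ∧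
      ∀ e : X, ‖NormedSpace.inclusionInDoubleDual 𝕜 X e + η‖ = ‖e‖ + 1 := by
  rw [IsReflexiveSpace, Function.Surjective] at hY
  push Not at hY
  obtain ⟨ξ, hξ⟩ := hY
  let ξX : StrongDual 𝕜 (StrongDual 𝕜 X) := ξ.comp (ContinuousLinearMap.precomp 𝕜 Y.subtypeL)
  have hξX : ∀ φ : StrongDual 𝕜 X, ξX φ = ξ (φ.comp Y.subtypeL) := fun φ => rfl
  have hmem : ξX ∉ (NormedSpace.inclusionInDoubleDual 𝕜 X).range := by
    rintro ⟨x, hx⟩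
    obtain ⟨y, hy⟩ := exists_eq_inclusionInDoubleDual_of_comp_restrict Y hYc ξ x
      fun φ => by rw [← hξX, ← hx]; rfl
    exact hξ y hy
  obtain ⟨_, ⟨x, rfl⟩, c, hc, horth⟩ := IsLSummand.exists_norm_add_eq hX hmem
  refine ⟨c • x, _, hc, fun φ hφ => ?_, fun e => ?_⟩
  · have h0 : ξX φ = 0 := by
      have : φ.comp Y.subtypeL = 0 := by
        ext y
        exact hφ y y.2
      rw [hξX, this, map_zero]
    change c • (ξX φ - φ x) = -φ (c • x)
    rw [h0, zero_sub, smul_neg, map_smul]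
  · rw [← (NormedSpace.inclusionInDoubleDualLi 𝕜 (E := X)).norm_map e]
    exact horth _ ⟨e, rfl⟩

/-! ### Sequences spanning `ℓ¹` asymptotically isometrically -/

/-- It suffices to check the lower estimate on finitely supported coefficients. -/
theorem SpansL1Asymptotically.of_sum_range {𝕜 E : Type*} [RCLike 𝕜]
    [NormedAddCommGroup E] [NormedSpace 𝕜 E] [CompleteSpace E] {y : ℕ → E} {δ : ℕ → ℝ}
    (hδ : ∀ n, 0 ≤ δ n ∧ δ n < 1) (hδ0 : Filter.Tendsto δ Filter.atTop (nhds 0))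
    (hy : ∀ n, ‖y n‖ ≤ 1)
    (h : ∀ (N : ℕ) (α : ℕ → 𝕜), ∑ n ∈ Finset.range N, (1 - δ n) * ‖α n‖ ≤
      ‖∑ n ∈ Finset.range N, α n • y n‖) :
    SpansL1Asymptotically 𝕜 y := by
  refine ⟨δ, hδ, hδ0, fun α hα => ?_⟩
  have hle : ∀ n, ‖α n • y n‖ ≤ ‖α n‖ := fun n => by
    rw [norm_smul]
    exact mul_le_of_le_one_right (norm_nonneg _) (hy n)
  have hs : Summable fun n => α n • y n := Summable.of_norm_bounded hα hle
  refine ⟨hs, ?_, tsum_of_norm_bounded hα.hasSum hle⟩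
  have hs' : Summable fun n => (1 - δ n) * ‖α n‖ :=
    Summable.of_nonneg_of_le (fun n => mul_nonneg (by linarith [(hδ n).2]) (norm_nonneg _))
      (fun n => mul_le_of_le_one_left (norm_nonneg _) (by linarith [(hδ n).1])) hα
  exact le_of_tendsto_of_tendsto' hs'.hasSum.tendsto_sum_nat
    hs.hasSum.tendsto_sum_nat.norm fun N => h N α

/-- If `z` satisfies lower `ℓ¹`-estimates with constants tending to one and lies in a translate of
`Y`, then the differences `z (2 n) - z (2 n + 1)`, scaled to norm at most one, lie in `Y` and still
span `ℓ¹` asymptotically isometrically: since the terms of a difference are almost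
`ℓ¹`-orthogonal, its norm is close to `2`. -/
theorem exists_spansL1Asymptotically_of_translate {𝕜 X : Type*} [RCLike 𝕜]
    [NormedAddCommGroup X] [NormedSpace 𝕜 X] (Y : Submodule 𝕜 X) [CompleteSpace Y] (x : X)
    (z : ℕ → X) (hzY : ∀ n, z n + x ∈ Y) (hz : ∀ n, ‖z n‖ ≤ 1 + (1 / 2 : ℝ) ^ (n + 2))
    (h : ∀ (N : ℕ) (α : ℕ → 𝕜), ∑ i ∈ Finset.range N, (1 - (1 / 2 : ℝ) ^ (i + 1)) * ‖α i‖ ≤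
      ‖∑ i ∈ Finset.range N, α i • z i‖) :
    ∃ y : ℕ → Y, SpansL1Asymptotically 𝕜 y := by
  let q : ℕ → ℝ := fun n => (1 / 2) ^ (2 * n + 2)
  have hq0 : ∀ n, 0 < q n := fun n => by positivity
  have hq1 : ∀ n, q n ≤ 1 / 4 := fun n => by
    calc q n ≤ (1 / 2) ^ 2 := pow_le_pow_of_le_one (by norm_num) (by norm_num) (by omega)
      _ = 1 / 4 := by norm_num
  have hqlim : Filter.Tendsto q Filter.atTop (nhds 0) := by
    refine (tendsto_pow_atTop_nhds_zero_of_lt_one (r := (1 / 2 : ℝ))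
      (by norm_num) (by norm_num)).comp ?_
    exact Filter.tendsto_atTop_mono (fun n => (by omega : n ≤ 2 * n + 2)) Filter.tendsto_id
  let c : ℕ → ℝ := fun n => (1 - q n) / 2
  have hc : ∀ n, 0 < c n := fun n => by have := hq1 n; simp only [c]; linarith
  have hmem : ∀ n, z (2 * n) - z (2 * n + 1) ∈ Y := fun n => by
    simpa using Y.sub_mem (hzY (2 * n)) (hzY (2 * n + 1))
  let y : ℕ → Y := fun n => (c n : 𝕜) • ⟨z (2 * n) - z (2 * n + 1), hmem n⟩
  have hnc : ∀ n, ‖(c n : 𝕜)‖ = c n := fun n => by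
    rw [RCLike.norm_ofReal, abs_of_pos (hc n)]
  refine ⟨y, SpansL1Asymptotically.of_sum_range (δ := fun n => 1 - (1 - q n) * (1 - 2 * q n))
    (fun n => ⟨?_, ?_⟩) ?_ (fun n => ?_) (fun N α => ?_)⟩
  · nlinarith [hq0 n, hq1 n]
  · nlinarith [hq0 n, hq1 n]
  · simpa using ((hqlim.const_sub 1).mul ((hqlim.const_mul 2).const_sub 1)).const_sub 1
  · have h1 := hz (2 * n)
    have h2 := hz (2 * n + 1)
    have h3 : (1 / 2 : ℝ) ^ (2 * n + 1 + 2) ≤ q n :=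
      pow_le_pow_of_le_one (by norm_num) (by norm_num) (by omega)
    have h4 : ‖z (2 * n) - z (2 * n + 1)‖ ≤ 2 * (1 + q n) := by
      have := norm_sub_le (z (2 * n)) (z (2 * n + 1))
      simp only [q] at h3 ⊢
      linarith
    calc ‖y n‖ = c n * ‖z (2 * n) - z (2 * n + 1)‖ := by
          simp only [y, norm_smul, hnc]; rfl
      _ ≤ c n * (2 * (1 + q n)) := mul_le_mul_of_nonneg_left h4 (hc n).le
      _ = 1 - q n ^ 2 := by simp only [c]; ring
      _ ≤ 1 := by nlinarith [hq0 n]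
  · -- The coefficients of the combination of differences with respect to `z`.
    let β : ℕ → 𝕜 := fun i => (if i % 2 = 0 then 1 else -1) * (α (i / 2) * (c (i / 2) : 𝕜))
    have hβ0 : ∀ n, β (2 * n) = α n * (c n : 𝕜) := fun n => by
      simp [β]
    have hβ1 : ∀ n, β (2 * n + 1) = -(α n * (c n : 𝕜)) := fun n => by
      have h1 : (2 * n + 1) % 2 = 1 := by omega
      have h2 : (2 * n + 1) / 2 = n := by omega
      simp [β, h1, h2]
    have hsum : ∀ N, ∑ i ∈ Finset.range (2 * N), β i • z i =
        ((∑ n ∈ Finset.range N, α n • y n : Y) : X) := by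
      intro N
      induction N with
      | zero => simp
      | succ N ih =>
        rw [Nat.mul_succ, Finset.sum_range_succ, Finset.sum_range_succ, ih,
          Finset.sum_range_succ, hβ0, hβ1, Submodule.coe_add]
        simp only [y, Submodule.coe_smul, smul_smul, smul_sub, neg_smul]
        abel
    have hlow : ∀ N, ∑ n ∈ Finset.range N, (1 - q n) * (1 - 2 * q n) * ‖α n‖ ≤
        ∑ i ∈ Finset.range (2 * N), (1 - (1 / 2 : ℝ) ^ (i + 1)) * ‖β i‖ := by
      intro N
      induction N with
      | zero => simp
      | succ N ih =>
        rw [Nat.mul_succ, Finset.sum_range_succ, Finset.sum_range_succ, Finset.sum_range_succ,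
          hβ0, hβ1, norm_neg, norm_mul, hnc]
        have h1 : (1 / 2 : ℝ) ^ (2 * N + 1) = 2 * q N := by
          simp only [q]; rw [pow_succ _ (2 * N + 1)]; ring
        have h2 : (1 / 2 : ℝ) ^ (2 * N + 1 + 1) = q N := rfl
        rw [h1, h2]
        have h3 : (1 - q N) * (1 - 2 * q N) * ‖α N‖ ≤
            (1 - 2 * q N) * (‖α N‖ * c N) + (1 - q N) * (‖α N‖ * c N) := by
          have h4 : 0 ≤ ‖α N‖ * c N := mul_nonneg (norm_nonneg _) (hc N).le
          have h5 : (1 - q N) * (1 - 2 * q N) * ‖α N‖ =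
              2 * ((1 - 2 * q N) * (‖α N‖ * c N)) := by simp only [c]; ring
          rw [h5]
          nlinarith [hq0 N]
        linarith
    simp only [sub_sub_cancel]
    refine (hlow N).trans ((h (2 * N) β).trans_eq ?_)
    rw [hsum, Submodule.coe_norm]

/-- A nonreflexive closed subspace of an L-embedded Banach space contains a sequence spanning
`ℓ¹` asymptotically isometrically. -/
theorem IsLEmbedded.exists_spansL1Asymptotically {𝕜 X : Type*} [RCLike 𝕜]
    [NormedAddCommGroup X] [NormedSpace 𝕜 X] [CompleteSpace X] (hX : IsLEmbedded 𝕜 X)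
    (Y : Submodule 𝕜 X) (hYc : IsClosed (Y : Set X)) (hY : ¬ IsReflexiveSpace 𝕜 Y) :
    ∃ y : ℕ → Y, SpansL1Asymptotically 𝕜 y := by
  have : CompleteSpace Y := hYc.completeSpace_coe
  obtain ⟨x, η, hη1, hη, horth⟩ := hX.exists_singular Y hYc hY
  obtain ⟨z, hz, hlow⟩ := exists_seq_of_almost_orthogonal (𝕜 := 𝕜)
    (fun n z => z + x ∈ Y ∧ ‖z‖ < 1 + (1 / 2 : ℝ) ^ (n + 2)) fun F _ n => by
      obtain ⟨z, h1, h2, h3⟩ := exists_translate_mem_almost_orthogonal Y hYc x η hη1 hη horth F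
        (ε := (1 / 2 : ℝ) ^ (n + 2)) (by positivity)
      exact ⟨z, ⟨h1, h2⟩, h3⟩
  exact exists_spansL1Asymptotically_of_translate Y x z (fun n => (hz n).1)
    (fun n => (hz n).2.le) hlow

/-! ### The synthesis operator on `ℓ¹` -/

namespace lp

theorem norm_eq_tsum_norm {ι F : Type*} [NormedAddCommGroup F] (a : lp (fun _ : ι => F) 1) :
    ‖a‖ = ∑' n, ‖a n‖ := by
  simp [lp.norm_eq_tsum_rpow (p := 1) (by simp) a]

theorem summable_norm_of_one {ι F : Type*} [NormedAddCommGroup F]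
    (a : lp (fun _ : ι => F) 1) : Summable fun n => ‖a n‖ := by
  simpa using (lp.memℓp a).summable (by simp)

variable {𝕜 E : Type*} [RCLike 𝕜] [NormedAddCommGroup E] [NormedSpace 𝕜 E] [CompleteSpace E]
  {x : ℕ → E} {M : ℝ}

theorem summable_smul_of_norm_le (hx : ∀ n, ‖x n‖ ≤ M) (a : lp (fun _ : ℕ => 𝕜) 1) :
    Summable fun n => a n • x n :=
  Summable.of_norm_bounded ((summable_norm_of_one a).mul_left M) fun n => by
    rw [norm_smul, mul_comm]
    exact mul_le_mul_of_nonneg_right (hx n) (norm_nonneg _)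

/-- The operator `ℓ¹ → E`, `a ↦ ∑ a n • x n`, of a bounded sequence `x`. -/
noncomputable def synthesis (x : ℕ → E) (hx : ∀ n, ‖x n‖ ≤ M) :
    lp (fun _ : ℕ => 𝕜) 1 →L[𝕜] E :=
  LinearMap.mkContinuous
    { toFun := fun a => ∑' n, a n • x n
      map_add' := fun a b => by
        simp only [lp.coeFn_add, Pi.add_apply, add_smul]
        exact (summable_smul_of_norm_le hx a).tsum_add (summable_smul_of_norm_le hx b)
      map_smul' := fun c a => by
        simp only [lp.coeFn_smul, Pi.smul_apply, smul_assoc, RingHom.id_apply]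
        exact (summable_smul_of_norm_le hx a).tsum_const_smul c }
    M fun a => by
      rw [norm_eq_tsum_norm, ← tsum_mul_left]
      refine tsum_of_norm_bounded ((summable_norm_of_one a).mul_left M).hasSum fun n => ?_
      rw [norm_smul, mul_comm]
      exact mul_le_mul_of_nonneg_right (hx n) (norm_nonneg _)

theorem synthesis_apply (hx : ∀ n, ‖x n‖ ≤ M) (a : lp (fun _ : ℕ => 𝕜) 1) :
    synthesis x hx a = ∑' n, a n • x n := rfl

end lp

/-! ### The copy of `ℓ¹` spanned by the sequence -/

namespace SpansL1Asymptotically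

variable {𝕜 E : Type*} [RCLike 𝕜] [NormedAddCommGroup E] [NormedSpace 𝕜 E] {x : ℕ → E}

theorem norm_le_one (hx : SpansL1Asymptotically 𝕜 x) (n : ℕ) : ‖x n‖ ≤ 1 := by
  obtain ⟨δ, -, -, h⟩ := hx
  have hs : Summable fun m => ‖(Pi.single n 1 : ℕ → 𝕜) m‖ :=
    summable_of_ne_finset_zero (s := {n}) fun m hm => by
      simp [Finset.notMem_singleton.1 hm]
  have h1 := (h _ hs).2.2
  rw [tsum_eq_single n fun m hm => by simp [hm],
    tsum_eq_single n fun m hm => by simp [hm]] at h1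
  simpa using h1

/-- The numbers `1 - δ n` tend to one and are positive, so they are bounded away from zero. -/
theorem exists_antilipschitz_synthesis [CompleteSpace E] (hx : SpansL1Asymptotically 𝕜 x) :
    ∃ K, AntilipschitzWith K (lp.synthesis (𝕜 := 𝕜) x hx.norm_le_one) := by
  obtain ⟨δ, hδ, hδ0, h⟩ := id hx
  have hlim : Filter.Tendsto (fun n => (1 - δ n)⁻¹) Filter.atTop (nhds (1 - 0)⁻¹) :=
    (hδ0.const_sub 1).inv₀ (by norm_num)
  obtain ⟨K, hK⟩ := hlim.bddAbove_range
  have hK' : ∀ n, (1 - δ n)⁻¹ ≤ K := fun n => hK ⟨n, rfl⟩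
  have hpos : ∀ n, 0 < 1 - δ n := fun n => by linarith [(hδ n).2]
  have hK0 : 0 ≤ K := (inv_pos.2 (hpos 0)).le.trans (hK' 0)
  refine ⟨K.toNNReal, ContinuousLinearMap.antilipschitz_of_bound _ fun a => ?_⟩
  have hs : Summable fun n => ‖a n‖ := lp.summable_norm_of_one a
  have hs' : Summable fun n => (1 - δ n) * ‖a n‖ :=
    Summable.of_nonneg_of_le (fun n => mul_nonneg (hpos n).le (norm_nonneg _))
      (fun n => mul_le_of_le_one_left (norm_nonneg _) (by linarith [(hδ n).1])) hs
  rw [Real.coe_toNNReal _ hK0, lp.synthesis_apply]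
  calc ‖a‖ = ∑' n, ‖a n‖ := lp.norm_eq_tsum_norm a
    _ ≤ ∑' n, K * ((1 - δ n) * ‖a n‖) := by
        refine hs.tsum_le_tsum (fun n => ?_) (hs'.mul_left K)
        rw [← mul_assoc]
        refine le_mul_of_one_le_left (norm_nonneg _) ?_
        exact (inv_mul_cancel₀ (hpos n).ne').ge.trans
          (mul_le_mul_of_nonneg_right (hK' n) (hpos n).le)
    _ = K * ∑' n, (1 - δ n) * ‖a n‖ := tsum_mul_left
    _ ≤ K * ‖∑' n, a n • x n‖ := mul_le_mul_of_nonneg_left (h _ hs).2.1 hK0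

/-- The range of the synthesis operator is an asymptotically isometric copy of `ℓ¹`, with the image
of the unit vector basis as its Schauder basis. -/
theorem containsAsymptoticL1 [CompleteSpace E] (hx : SpansL1Asymptotically 𝕜 x) :
    ContainsAsymptoticL1 𝕜 E := by
  obtain ⟨K, hK⟩ := hx.exists_antilipschitz_synthesis
  let T : lp (fun _ : ℕ => 𝕜) 1 →L[𝕜] E := lp.synthesis x hx.norm_le_one
  have hcl : IsClosed (Set.range T) := hK.isClosed_range T.uniformContinuous
  let e := T.equivRange hK.injective hcl
  have hsum : ∀ a : lp (fun _ : ℕ => 𝕜) 1, HasSum (fun n => a n • e (lp.single 1 n 1)) (e a) := by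
    intro a
    convert (lp.hasSum_single (by simp) a).map e e.continuous using 1
    ext1 n
    rw [Function.comp_apply, ← map_smul, ← lp.single_smul, smul_eq_mul, mul_one]
  let b : SchauderBasis 𝕜 T.range :=
    { basis := fun n => e (lp.single 1 n 1)
      coord := fun n => (lp.evalCLM 𝕜 (fun _ : ℕ => 𝕜) 1 n).comp e.symm.toContinuousLinearMap
      ortho := fun i j => by
        change (e.symm (e (lp.single 1 j 1)) : ℕ → 𝕜) i = _
        rw [e.symm_apply_apply, lp.coeFn_single]
        congr
      expansion := fun w => by
        rw [HasSum, SummationFilter.conditional_filter_eq_map_range, Filter.tendsto_map'_iff]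
        have h := (hsum (e.symm w)).tendsto_sum_nat
        rwa [e.apply_symm_apply] at h }
  refine ⟨T.range, hcl, b, ?_⟩
  obtain ⟨δ, hδ, hδ0, h⟩ := id hx
  refine ⟨δ, hδ, hδ0, fun α hα => ?_⟩
  let a : lp (fun _ : ℕ => 𝕜) 1 := ⟨α, memℓp_gen (by simpa using hα)⟩
  have ha : HasSum (fun n => α n • b.basis n) (e a) := hsum a
  have hTa : ((e a : T.range) : E) = ∑' n, α n • x n := rfl
  refine ⟨ha.summable, ?_⟩
  rw [ha.tsum_eq, Submodule.coe_norm, hTa]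
  exact (h α hα).2

end SpansL1Asymptotically

/-! ### Failure of the fixed point property -/

/-- If `∑ κ n |a n| ≤ ‖∑ a n • y n‖` with constants `κ n ≥ 1` exceeding `‖y (n + 1)‖`, then the
shift `∑ a n • y n ↦ ∑ a n • y (n + 1)` on the set of infinite convex combinations of `y` is
contractive, and it has no fixed point since `ℓ¹` contains no nonzero constant sequence. -/
theorem exists_isContractiveMap_forall_ne {E : Type*} [NormedAddCommGroup E] [NormedSpace ℝ E]
    [CompleteSpace E] (y : ℕ → E) (κ : ℕ → ℝ) {M : ℝ} (hy : ∀ n, ‖y n‖ ≤ M)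
    (hκ1 : ∀ n, 1 ≤ κ n) (hκM : ∀ n, κ n ≤ M) (hyκ : ∀ n, ‖y (n + 1)‖ < κ n)
    (h : ∀ a : lp (fun _ : ℕ => ℝ) 1, ∑' n, κ n * ‖a n‖ ≤ ‖∑' n, a n • y n‖) :
    ∃ C : Set E, C.Nonempty ∧ IsClosed C ∧ Bornology.IsBounded C ∧ Convex ℝ C ∧
      ∃ f : C → C, IsContractiveMap f ∧ ∀ c, f c ≠ c := by
  let T : lp (fun _ : ℕ => ℝ) 1 →L[ℝ] E := lp.synthesis y hy
  let U : lp (fun _ : ℕ => ℝ) 1 →L[ℝ] E := lp.synthesis (fun n => y (n + 1)) fun n => hy (n + 1)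
  let σ : lp (fun _ : ℕ => ℝ) 1 →L[ℝ] ℝ := lp.tsumCLM ℝ ℕ ℝ
  have hσ : ∀ a, σ a = ∑' n, a n := fun a => rfl
  let D : Set (lp (fun _ : ℕ => ℝ) 1) := {a | (∀ n, 0 ≤ a n) ∧ σ a = 1}
  have hs : ∀ a : lp (fun _ : ℕ => ℝ) 1, Summable fun n => κ n * ‖a n‖ := fun a =>
    Summable.of_nonneg_of_le
      (fun n => mul_nonneg (zero_le_one.trans (hκ1 n)) (norm_nonneg _))
      (fun n => mul_le_mul_of_nonneg_right (hκM n) (norm_nonneg _))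
      ((lp.summable_norm_of_one a).mul_left M)
  have hT : AntilipschitzWith 1 T := ContinuousLinearMap.antilipschitz_of_bound _ fun a => by
    rw [lp.norm_eq_tsum_norm, NNReal.coe_one, one_mul]
    refine le_trans ?_ (h a)
    exact (lp.summable_norm_of_one a).tsum_le_tsum
      (fun n => le_mul_of_one_le_left (norm_nonneg _) (hκ1 n)) (hs a)
  have hcontr : ∀ a, a ≠ 0 → ‖U a‖ < ‖T a‖ := by
    intro a ha
    obtain ⟨m, hm⟩ : ∃ m, a m ≠ 0 := by
      by_contra! hall
      exact ha (lp.ext (funext hall))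
    have hle : ∀ n, ‖a n • y (n + 1)‖ ≤ ‖y (n + 1)‖ * ‖a n‖ := fun n => by
      rw [norm_smul, mul_comm]
    have hs₂ : Summable fun n => ‖y (n + 1)‖ * ‖a n‖ :=
      Summable.of_nonneg_of_le (fun n => by positivity)
        (fun n => mul_le_mul_of_nonneg_right (hyκ n).le (norm_nonneg _)) (hs a)
    calc ‖U a‖ ≤ ∑' n, ‖y (n + 1)‖ * ‖a n‖ := tsum_of_norm_bounded hs₂.hasSum hle
      _ < ∑' n, κ n * ‖a n‖ :=
        hs₂.tsum_lt_tsum (i := m)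
          (fun n => mul_le_mul_of_nonneg_right (hyκ n).le (norm_nonneg _))
          (mul_lt_mul_of_pos_right (hyκ m) (norm_pos_iff.2 hm)) (hs a)
      _ ≤ ‖T a‖ := h a
  have hDclosed : IsClosed D := by
    have h1 : IsClosed {a : lp (fun _ : ℕ => ℝ) 1 | ∀ n, 0 ≤ a n} := by
      rw [Set.ofPred_forall]
      exact isClosed_iInter fun n =>
        isClosed_le continuous_const (lp.evalCLM ℝ (fun _ : ℕ => ℝ) 1 n).continuous
    exact h1.inter (isClosed_eq σ.continuous continuous_const)
  have hDnorm : ∀ a ∈ D, ‖a‖ = 1 := fun a ha => by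
    rw [lp.norm_eq_tsum_norm, ← ha.2, hσ]
    exact tsum_congr fun n => Real.norm_of_nonneg (ha.1 n)
  have hDconv : Convex ℝ D := by
    intro a ha b hb s t hs ht hst
    refine ⟨fun n => ?_, ?_⟩
    · have h1 := ha.1 n
      have h2 := hb.1 n
      simp only [lp.coeFn_add, lp.coeFn_smul, Pi.add_apply, Pi.smul_apply, smul_eq_mul]
      positivity
    · rw [map_add, map_smul, map_smul, ha.2, hb.2]
      simpa using hst
  -- Shifting coefficients stays in `D`, so `U a` is again of the form `T b` with `b ∈ D`.
  have hshift : ∀ a ∈ D, ∃ b ∈ D, T b = U a ∧ b 0 = 0 ∧ ∀ n, b (n + 1) = a n := by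
    intro a ha
    let β : ℕ → ℝ := fun n => Nat.casesOn n 0 fun k => a k
    have hβ : Summable fun n => ‖β n‖ :=
      (summable_nat_add_iff 1).1 (lp.summable_norm_of_one a)
    let b : lp (fun _ : ℕ => ℝ) 1 := ⟨β, memℓp_gen (by simpa using hβ)⟩
    have hb0 : b 0 = 0 := rfl
    have hb1 : ∀ n, b (n + 1) = a n := fun n => rfl
    refine ⟨b, ⟨fun n => ?_, ?_⟩, ?_, hb0, hb1⟩
    · cases n with
      | zero => exact hb0.ge
      | succ n => rw [hb1]; exact ha.1 n
    · rw [← ha.2, hσ, hσ, hβ.of_norm.tsum_eq_zero_add]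
      change b 0 + ∑' n, b (n + 1) = _
      simp only [hb0, hb1, zero_add]
    · change ∑' n, b n • y n = ∑' n, a n • y (n + 1)
      rw [(lp.summable_smul_of_norm_le hy b).tsum_eq_zero_add]
      simp only [hb0, hb1, zero_add, zero_smul]
  choose g hgD hg using fun c : T '' D => c.2
  let f : T '' D → T '' D := fun c => ⟨U (g c), by
    obtain ⟨b, hb, hbU, -⟩ := hshift (g c) (hgD c)
    exact ⟨b, hb, hbU⟩⟩
  refine ⟨T '' D, ?_, ?_, ?_, hDconv.linear_image T.toLinearMap, f, ?_, ?_⟩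
  · refine ⟨_, lp.single 1 0 1, ⟨fun n => ?_, ?_⟩, rfl⟩
    · rw [lp.coeFn_single, Pi.single_apply]
      split_ifs <;> norm_num
    · rw [hσ, tsum_eq_single 0 fun n hn => by simp [hn]]
      simp
  · exact (hT.isClosedEmbedding T.uniformContinuous).isClosedMap _ hDclosed
  · refine T.lipschitz.isBounded_image ?_
    exact isBounded_iff_forall_norm_le.2 ⟨1, fun a ha => (hDnorm a ha).le⟩
  · intro c d hcd
    have hne : g c - g d ≠ 0 := fun h0 => hcd <| Subtype.ext <| by
      rw [← hg c, ← hg d, sub_eq_zero.1 h0]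
    have := hcontr _ hne
    rwa [map_sub, map_sub, hg, hg] at this
  · intro c hc
    obtain ⟨b, hb, hbU, hb0, hb1⟩ := hshift (g c) (hgD c)
    have hfix : b = g c := hT.injective (by
      rw [hbU, hg]
      exact congrArg Subtype.val hc)
    have hzero : ∀ n, b n = 0 := by
      intro n
      induction n with
      | zero => exact hb0
      | succ n ih => rw [hb1, ← hfix, ih]
    have := hb.2
    rw [hσ] at this
    simp [hzero] at this

/-- A sequence spanning `ℓ¹` asymptotically isometrically has a subsequence along which `δ`
is so small that the vectors `(1 + 2⁻¹ ^ n) • x (k n)` admit a contractive shift. -/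
theorem SpansL1Asymptotically.not_hasFixedPointProperty {𝕜 E : Type*} [RCLike 𝕜]
    [NormedAddCommGroup E] [NormedSpace 𝕜 E] [CompleteSpace E] {x : ℕ → E}
    (hx : SpansL1Asymptotically 𝕜 x) : ¬ HasFixedPointProperty 𝕜 E := by
  let _ : NormedSpace ℝ E := NormedSpace.restrictScalars ℝ 𝕜 E
  have hsmul : ∀ (r : ℝ) (v : E), r • v = (r : 𝕜) • v := fun r v => by
    rw [← RCLike.algebraMap_eq_ofReal]; rfl
  have hx1 := hx.norm_le_one
  obtain ⟨δ, hδ, hδ0, hlow⟩ := hx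
  let r : ℕ → ℝ := fun n => 1 + (1 / 2) ^ n
  have hr1 : ∀ n, 1 < r n := fun n => by simp only [r, lt_add_iff_pos_right]; positivity
  have hr2 : ∀ n, r n ≤ 2 := fun n => by
    have : (1 / 2 : ℝ) ^ n ≤ 1 := pow_le_one₀ (by norm_num) (by norm_num)
    simp only [r]
    linarith
  have hrlt : ∀ n, r (n + 1) < r n := fun n => by
    simp only [r]
    gcongr ?_ + ?_
    exact pow_lt_pow_right_of_lt_one₀ (by norm_num) (by norm_num) (Nat.lt_succ_self n)
  obtain ⟨k, hk, hkr⟩ : ∃ k : ℕ → ℕ, StrictMono k ∧ ∀ n, r (n + 1) < (1 - δ (k n)) * r n := by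
    refine Filter.extraction_forall_of_eventually
      (P := fun n m => r (n + 1) < (1 - δ m) * r n) fun n => ?_
    have : Filter.Tendsto (fun m => (1 - δ m) * r n) Filter.atTop (nhds ((1 - 0) * r n)) :=
      (hδ0.const_sub 1).mul_const _
    exact this.eventually_const_lt (by simpa using hrlt n)
  have hny : ∀ n, ‖r n • x (k n)‖ ≤ r n := fun n => by
    rw [norm_smul, Real.norm_of_nonneg (by linarith [hr1 n])]
    exact mul_le_of_le_one_right (by linarith [hr1 n]) (hx1 _)
  obtain ⟨C, hCne, hCcl, hCb, hCconv, f, hf, hfix⟩ := exists_isContractiveMap_forall_ne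
    (fun n => r n • x (k n)) (fun n => (1 - δ (k n)) * r n) (M := 2)
    (fun n => (hny n).trans (hr2 n)) (fun n => (hr1 (n + 1)).le.trans (hkr n).le)
    (fun n => (mul_le_of_le_one_left (by linarith [hr1 n]) (by linarith [(hδ (k n)).1])).trans
      (hr2 n))
    (fun n => (hny (n + 1)).trans_lt (hkr n)) fun a => by
      -- Extend the coefficients by zero to the whole sequence `x`.
      let α : ℕ → 𝕜 := Function.extend k (fun n => ((a n * r n : ℝ) : 𝕜)) 0
      have hαk : ∀ n, α (k n) = ((a n * r n : ℝ) : 𝕜) := fun n => hk.injective.extend_apply _ _ _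
      have hα0 : ∀ m ∉ Set.range k, α m = 0 := fun m hm => Function.extend_apply' _ _ _ hm
      have hnα : ∀ n, ‖α (k n)‖ = r n * ‖a n‖ := fun n => by
        rw [hαk, RCLike.norm_ofReal, abs_mul, abs_of_pos (by linarith [hr1 n] : 0 < r n),
          Real.norm_eq_abs, mul_comm]
      have hαs : Summable fun m => ‖α m‖ := by
        rw [← hk.injective.summable_iff fun m hm => by rw [hα0 m hm, norm_zero]]
        refine Summable.of_nonneg_of_le (fun n => norm_nonneg _) (fun n => ?_)
          ((lp.summable_norm_of_one a).mul_left 2)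
        rw [Function.comp_apply, hnα]
        exact mul_le_mul_of_nonneg_right (hr2 n) (norm_nonneg _)
      have h1 := (hlow α hαs).2.1
      rw [← hk.injective.tsum_eq (f := fun m => (1 - δ m) * ‖α m‖),
        ← hk.injective.tsum_eq (f := fun m => α m • x m)] at h1
      · simp only [hnα] at h1
        simpa only [hαk, mul_assoc, smul_smul, hsmul, ← RCLike.ofReal_mul] using h1
      · intro m hm
        by_contra hmk
        exact hm (by simp [hα0 m hmk])
      · intro m hm
        by_contra hmk
        exact hm (by simp [hα0 m hmk])
  intro hfpp
  obtain ⟨c, hc⟩ := hfpp C hCne hCcl hCb hCconv f hf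
  exact hfix c hc

/-! ### Subspaces of L-embedded spaces -/

theorem mainTheorem4 {𝕜 : Type*} [RCLike 𝕜] {X : Type*} [NormedAddCommGroup X]
    [NormedSpace 𝕜 X] [CompleteSpace X] (hX : IsLEmbedded 𝕜 X)
    (Y : Submodule 𝕜 X) (hYc : IsClosed (Y : Set X)) (hY : ¬ IsReflexiveSpace 𝕜 Y) :
    ContainsAsymptoticL1 𝕜 Y ∧ ¬ HasFixedPointProperty 𝕜 Y := by
  have : CompleteSpace Y := hYc.completeSpace_coe
  obtain ⟨y, hy⟩ := hX.exists_spansL1Asymptotically Y hYc hY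
  exact ⟨hy.containsAsymptoticL1, hy.not_hasFixedPointProperty⟩
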